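/- Let $X$ be a real or complex Banach space with dual $X^*$. For a Banach space $Y$ let $\mathcal F(Y)$ be the Banach algebra of approximable operators on $Y$, i.e. the closure in operator norm of the bounded finite rank operators $Y\to Y$, with composition as product. A Banach algebra $\mathcal A$ (not necessarily unital) is called amenable if, for every Banach $\mathcal A$-bimodule $E$, every continuous derivation $D:\mathcal A\to E^*$ is inner. Here a Banach $\mathcal A$-bimodule is a Banach space $E$ with a bimodule structure whose (bilinear) actions satisfy $\|a.x\|\le K\|a\|\,\|x\|$ and $\|x.a\|\le K\|a\|\,\|x\|$ for some constant $K$; the dual $E^*$ carries the actions $\langle a.f,x\rangle=\langle f,x.a\rangle$ and $\langle f.a,x\rangle=\langle f,a.x\rangle$; a derivation into $E^*$ is a linear map with $D(ab)=a.D(b)+D(a).b$; and $D$ is inner if there is $f\in E^*$ with $D(a)=a.f-f.a$ for all $a\in\mathcal A$. If $\mathcal F(X^*)$ is amenable, then $\mathcal F(X)$ is amenable. -/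

import Mathlib

universe u v

section ApproximableOperators

variable (𝕜 : Type*) [RCLike 𝕜] (X : Type*) [NormedAddCommGroup X] [NormedSpace 𝕜 X]

/-- The algebra `F(X)` of bounded finite rank operators on `X`. It need not contain the identity,
so it is a non-unital subalgebra of the algebra of all bounded operators. -/
def finiteRankOperators : NonUnitalSubalgebra 𝕜 (X →L[𝕜] X) where
  carrier := {T | FiniteDimensional 𝕜 (LinearMap.range (T : X →ₗ[𝕜] X))}
  zero_mem' := by
    have h : LinearMap.range ((0 : X →L[𝕜] X) : X →ₗ[𝕜] X) = ⊥ := by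
      rw [ContinuousLinearMap.toLinearMap_zero, LinearMap.range_zero]
    change FiniteDimensional 𝕜 (LinearMap.range ((0 : X →L[𝕜] X) : X →ₗ[𝕜] X))
    rw [h]
    infer_instance
  add_mem' := by
    intro S T hS hT
    change FiniteDimensional 𝕜 (LinearMap.range (S : X →ₗ[𝕜] X)) at hS
    change FiniteDimensional 𝕜 (LinearMap.range (T : X →ₗ[𝕜] X)) at hT
    have h : LinearMap.range ((S + T : X →L[𝕜] X) : X →ₗ[𝕜] X) ≤
        LinearMap.range (S : X →ₗ[𝕜] X) ⊔ LinearMap.range (T : X →ₗ[𝕜] X) := by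
      rintro _ ⟨x, rfl⟩
      exact Submodule.add_mem_sup ⟨x, rfl⟩ ⟨x, rfl⟩
    exact Submodule.finiteDimensional_of_le h
  mul_mem' := by
    intro S T hS _
    change FiniteDimensional 𝕜 (LinearMap.range (S : X →ₗ[𝕜] X)) at hS
    have h : LinearMap.range ((S * T : X →L[𝕜] X) : X →ₗ[𝕜] X) ≤
        LinearMap.range (S : X →ₗ[𝕜] X) := by
      rintro _ ⟨x, rfl⟩
      exact ⟨T x, rfl⟩
    exact Submodule.finiteDimensional_of_le h
  smul_mem' := by
    intro c T hT
    change FiniteDimensional 𝕜 (LinearMap.range (T : X →ₗ[𝕜] X)) at hT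
    have h : LinearMap.range ((c • T : X →L[𝕜] X) : X →ₗ[𝕜] X) ≤
        LinearMap.range (T : X →ₗ[𝕜] X) := by
      rintro _ ⟨x, rfl⟩
      exact Submodule.smul_mem _ c ⟨x, rfl⟩
    exact Submodule.finiteDimensional_of_le h

/-- The algebra `𝓕(X)` of approximable operators on `X`: the closure of the finite rank operators
in the operator norm. It carries the operator norm and composition as its product. -/
def approximableOperators : NonUnitalSubalgebra 𝕜 (X →L[𝕜] X) :=
  (finiteRankOperators 𝕜 X).topologicalClosure

instance approximableOperators.instNormedSpace : NormedSpace 𝕜 (approximableOperators 𝕜 X) where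
  norm_smul_le c T := norm_smul_le c (T : X →L[𝕜] X)

instance approximableOperators.instCompleteSpace [CompleteSpace X] :
    CompleteSpace (approximableOperators 𝕜 X) :=
  (NonUnitalSubalgebra.isClosed_topologicalClosure
    (finiteRankOperators 𝕜 X)).isComplete.completeSpace_coe

end ApproximableOperators

section Amenability

/-- A Banach `A`-bimodule structure on the Banach space `E`: a left and a right action which are
bilinear and bounded, that is, `‖a.x‖ ≤ K ‖a‖ ‖x‖` and `‖x.a‖ ≤ K ‖a‖ ‖x‖` for some constant `K`.
Both actions are bundled as bounded bilinear maps: `left a x` is `a.x` and `right a x` is `x.a`. -/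
structure BanachBimodule (𝕜 : Type*) [RCLike 𝕜]
    (A : Type*) [NonUnitalNormedRing A] [NormedSpace 𝕜 A]
    (E : Type*) [NormedAddCommGroup E] [NormedSpace 𝕜 E] where
  /-- the left action `a.x` -/
  left : A →L[𝕜] E →L[𝕜] E
  /-- the right action `x.a` -/
  right : A →L[𝕜] E →L[𝕜] E
  left_mul : ∀ (a b : A) (x : E), left (a * b) x = left a (left b x)
  right_mul : ∀ (a b : A) (x : E), right (a * b) x = right b (right a x)
  left_right : ∀ (a b : A) (x : E), left a (right b x) = right b (left a x)

namespace BanachBimodule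

variable {𝕜 : Type*} [RCLike 𝕜] {A : Type*} [NonUnitalNormedRing A] [NormedSpace 𝕜 A]
  {E : Type*} [NormedAddCommGroup E] [NormedSpace 𝕜 E]

/-- The dual bimodule: the actions of `A` on `E*` with `⟨a.f, x⟩ = ⟨f, x.a⟩` and
`⟨f.a, x⟩ = ⟨f, a.x⟩`. -/
noncomputable def dual (M : BanachBimodule 𝕜 A E) : BanachBimodule 𝕜 A (StrongDual 𝕜 E) where
  left := (ContinuousLinearMap.compL 𝕜 E E 𝕜).flip ∘L M.right
  right := (ContinuousLinearMap.compL 𝕜 E E 𝕜).flip ∘L M.left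
  left_mul a b f := by
    ext x
    simp [M.right_mul]
  right_mul a b f := by
    ext x
    simp [M.left_mul]
  left_right a b f := by
    ext x
    simp [M.left_right]

theorem dual_left_apply (M : BanachBimodule 𝕜 A E) (a : A) (f : StrongDual 𝕜 E) (x : E) :
    M.dual.left a f x = f (M.right a x) := rfl

theorem dual_right_apply (M : BanachBimodule 𝕜 A E) (a : A) (f : StrongDual 𝕜 E) (x : E) :
    M.dual.right a f x = f (M.left a x) := rfl

/-- A continuous linear map `D : A → E` is a derivation if `D(ab) = a.D(b) + D(a).b`. -/
def IsDerivation (M : BanachBimodule 𝕜 A E) (D : A →L[𝕜] E) : Prop :=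
  ∀ a b : A, D (a * b) = M.left a (D b) + M.right b (D a)

/-- A map `D : A → E` is an inner derivation if it is `a ↦ a.x - x.a` for some `x` in `E`. -/
def IsInner (M : BanachBimodule 𝕜 A E) (D : A →L[𝕜] E) : Prop :=
  ∃ x : E, ∀ a : A, D a = M.left a x - M.right a x

end BanachBimodule

/-- The Banach algebra `A` (not assumed to be unital) is amenable if, for every Banach
`A`-bimodule `E`, every continuous derivation from `A` into the dual bimodule `E*` is inner.
The universe `v` is the one in which the bimodules `E` live. -/
def IsAmenable (𝕜 : Type) [RCLike 𝕜] (A : Type u) [NonUnitalNormedRing A] [NormedSpace 𝕜 A]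
    [IsScalarTower 𝕜 A A] [SMulCommClass 𝕜 A A] [CompleteSpace A] : Prop :=
  ∀ (E : Type v) [NormedAddCommGroup E] [NormedSpace 𝕜 E] [CompleteSpace E]
    (M : BanachBimodule 𝕜 A E) (D : A →L[𝕜] StrongDual 𝕜 E),
    M.dual.IsDerivation D → M.dual.IsInner D

end Amenability

/-! Write A = F(X) and B = F(X*). Amenability is equivalent to the existence of a virtual diagonal
(`IsAmenable.exists_isVirtualDiagonal`, `IsVirtualDiagonal.isInner`), so it suffices to carry one
from B to A. The adjoint map embeds A isometrically into B, reverses products, and has a left ideal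
as its image, because b ∘ (f ⊗ y)* = (b f ⊗ y)*. Let e stand for a virtual identity of A. A virtual
diagonal Σ a ⊗ b of B then yields Σ (b e*) ⊗ (a e*), read back in A; the factors swap because
adjoints reverse products (`IsVirtualDiagonal.of_leftIdeal`).

The virtual identity of A is also obtained from B. It must send the functional a ↦ ξ(a* f), with ξ
in X** and f in X*, to ξ(f). A virtual identity of B does this for b ↦ ξ(b f). By local reflexivity,
a linear combination of such functionals has norm over B at most twice its norm over A
(`norm_sum_coefficient_apply_le`), so Hahn–Banach provides the functional on A*.

Only modules built from B are tested, hence amenability of B in its own universe is enough, whereas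
a virtual diagonal of A handles bimodules in every universe. -/

/-! ### Virtual identities, virtual diagonals and inner derivations. -/

section VirtualDiagonal

variable {𝕜 : Type*} [RCLike 𝕜] {A : Type*} [NonUnitalNormedRing A] [NormedSpace 𝕜 A]

/-- A functional `m` on `A*` is a virtual identity if it is a mixed identity for the two module
actions of `A` on `A**`. -/
structure IsVirtualIdentity (m : StrongDual 𝕜 (StrongDual 𝕜 A)) : Prop where
  comp_mul_left : ∀ (ψ ψ' : StrongDual 𝕜 A) (c : A), (∀ a, ψ' a = ψ (c * a)) → m ψ' = ψ c
  comp_mul_right : ∀ (ψ ψ' : StrongDual 𝕜 A) (c : A), (∀ a, ψ' a = ψ (a * c)) → m ψ' = ψ c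

/-- A virtual diagonal for `A`, seen as a functional on the bounded bilinear forms on `A`. -/
structure IsVirtualDiagonal (M : StrongDual 𝕜 (A →L[𝕜] A →L[𝕜] 𝕜)) : Prop where
  balanced : ∀ (Φ Φ₁ Φ₂ : A →L[𝕜] A →L[𝕜] 𝕜) (c : A), (∀ a b, Φ₁ a b = Φ (c * a) b) →
    (∀ a b, Φ₂ a b = Φ a (b * c)) → M Φ₁ = M Φ₂
  comp_mul : ∀ (ψ : StrongDual 𝕜 A) (Φ : A →L[𝕜] A →L[𝕜] 𝕜) (c : A),
    (∀ a b, Φ a b = ψ (c * a * b)) → M Φ = ψ c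

variable [IsScalarTower 𝕜 A A] [SMulCommClass 𝕜 A A]

/-- The bilinear form `(a, b) ↦ ψ (a * b)`, as a bounded function of `ψ`. -/
noncomputable def mulForm (𝕜 : Type*) [RCLike 𝕜] (A : Type*) [NonUnitalNormedRing A]
    [NormedSpace 𝕜 A] [IsScalarTower 𝕜 A A] [SMulCommClass 𝕜 A A] :
    StrongDual 𝕜 A →L[𝕜] A →L[𝕜] A →L[𝕜] 𝕜 :=
  (ContinuousLinearMap.compL 𝕜 A (A →L[𝕜] A) (A →L[𝕜] 𝕜)).flip (ContinuousLinearMap.mul 𝕜 A) ∘L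
    ContinuousLinearMap.compL 𝕜 A A 𝕜

theorem mulForm_apply (ψ : StrongDual 𝕜 A) (a b : A) : mulForm 𝕜 A ψ a b = ψ (a * b) := rfl

/-- The right identity comes from the left one: balancing the form ψ(ab) moves c from the left of ab
to its right. -/
theorem IsVirtualDiagonal.isVirtualIdentity {M : StrongDual 𝕜 (A →L[𝕜] A →L[𝕜] 𝕜)}
    (hM : IsVirtualDiagonal M) : IsVirtualIdentity (M ∘L mulForm 𝕜 A) where
  comp_mul_left ψ ψ' c h := hM.comp_mul ψ _ c fun a b => by simp [mulForm_apply, h, mul_assoc]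
  comp_mul_right ψ ψ' c h := by
    have h1 : M ((mulForm 𝕜 A ψ) ∘L ContinuousLinearMap.mul 𝕜 A c) = ψ c :=
      hM.comp_mul ψ _ c fun a b => by simp [mulForm_apply]
    rw [← h1]
    exact (hM.balanced (mulForm 𝕜 A ψ) _ _ c (fun a b => by simp)
      (fun a b => by simp [mulForm_apply, h, mul_assoc])).symm

/-- For M = Σ a ⊗ b the usual witness Σ a.D(b) only produces e.D(c), where e is the virtual identity
`m`. Since D(c) = e.D(c) + g.c with g = D(e), the correction e.g - g supplies the missing g.c, and
no essentiality of the bimodule is needed. -/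
theorem IsVirtualDiagonal.isInner {M : StrongDual 𝕜 (A →L[𝕜] A →L[𝕜] 𝕜)}
    (hM : IsVirtualDiagonal M) {E : Type*} [NormedAddCommGroup E] [NormedSpace 𝕜 E]
    (N : BanachBimodule 𝕜 A E) (D : A →L[𝕜] StrongDual 𝕜 E) (hD : N.dual.IsDerivation D) :
    N.dual.IsInner D := by
  obtain ⟨m, hm⟩ : ∃ m, m = M ∘L mulForm 𝕜 A := ⟨_, rfl⟩
  have hmi : IsVirtualIdentity m := hm ▸ hM.isVirtualIdentity
  have hD' : ∀ a b x, D (a * b) x = D b (N.right a x) + D a (N.left b x) := fun a b x => by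
    rw [hD a b]; rfl
  obtain ⟨F, hF⟩ : ∃ F : E →L[𝕜] A →L[𝕜] A →L[𝕜] 𝕜, ∀ x a b, F x a b = D b (N.right a x) :=
    ⟨(ContinuousLinearMap.compL 𝕜 A E (A →L[𝕜] 𝕜) D.flip) ∘L N.right.flip, fun _ _ _ => rfl⟩
  let g : StrongDual 𝕜 E := m ∘L D.flip
  let k : StrongDual 𝕜 E := m ∘L (ContinuousLinearMap.compL 𝕜 A E 𝕜 g) ∘L N.right.flip
  have hg : ∀ x, g x = m (D.flip x) := fun _ => rfl
  have hk : ∀ x, k x = m (g ∘L N.right.flip x) := fun _ => rfl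
  refine ⟨M ∘L F - g + k, fun c => ?_⟩
  ext x
  have hr : m (D c ∘L N.right.flip x) = D c x - g (N.left c x) := by
    have h1 : m (D.flip (N.left c x) + D c ∘L N.right.flip x) = D.flip x c :=
      hmi.comp_mul_right _ _ c fun a => by simp [hD', add_comm]
    rw [map_add, ← hg] at h1
    rw [← ContinuousLinearMap.flip_apply D, ← h1]; ring
  have h1 : M (F (N.right c x)) = M (F (N.left c x)) + m (D c ∘L N.right.flip x) := by
    rw [hm, ContinuousLinearMap.comp_apply M, ← map_add M]
    refine hM.balanced (F x) _ _ c (fun a b => ?_) (fun a b => ?_)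
    · simp [hF, N.right_mul]
    · simp [hF, hD', mulForm_apply, N.left_right, N.right_mul, add_comm]
  have h2 : k (N.right c x) = g (N.right c x) :=
    hmi.comp_mul_left (g ∘L N.right.flip x) _ c fun a => by simp [N.right_mul]
  -- On vectors x.a the functionals e.D(c) and D(c) agree, so g.c vanishes there.
  have h3 : k (N.left c x) = 0 := by
    rw [hk]
    convert map_zero m
    ext a
    have h4 : m (D.flip (N.left c (N.right a x)) + D c ∘L N.right.flip (N.right a x)) =
        D.flip (N.right a x) c :=
      hmi.comp_mul_right _ _ c fun b => by simp [hD', add_comm]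
    have h5 : m (D c ∘L N.right.flip (N.right a x)) = D c (N.right a x) :=
      hmi.comp_mul_left (D c ∘L N.right.flip x) _ a fun b => by simp [N.right_mul]
    rw [map_add, ← hg, h5] at h4
    simpa [N.left_right] using h4
  have h6 : D c x = m (D c ∘L N.right.flip x) + g (N.left c x) := by rw [hr]; ring
  rw [sub_apply, N.dual_left_apply, N.dual_right_apply]
  simp only [add_apply, sub_apply,
    ContinuousLinearMap.comp_apply, h1, h2, h3, h6]
  ring

/-- The bimodule of bounded bilinear forms, with `(Φ.c)(a, b) = Φ(ca, b)` and
`(c.Φ)(a, b) = Φ(a, bc)`. -/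
noncomputable def bilinearFormBimodule (𝕜 : Type*) [RCLike 𝕜] (A : Type*) [NonUnitalNormedRing A]
    [NormedSpace 𝕜 A] [IsScalarTower 𝕜 A A] [SMulCommClass 𝕜 A A] :
    BanachBimodule 𝕜 A (A →L[𝕜] A →L[𝕜] 𝕜) where
  left := (ContinuousLinearMap.compL 𝕜 A (A →L[𝕜] 𝕜) (A →L[𝕜] 𝕜)) ∘L
    (ContinuousLinearMap.compL 𝕜 A A 𝕜).flip ∘L (ContinuousLinearMap.mul 𝕜 A).flip
  right := (ContinuousLinearMap.compL 𝕜 A A (A →L[𝕜] 𝕜)).flip ∘L ContinuousLinearMap.mul 𝕜 A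
  left_mul a b Φ := by ext; simp [mul_assoc]
  right_mul a b Φ := by ext; simp [mul_assoc]
  left_right a b Φ := by ext; simp

theorem bilinearFormBimodule_left_apply (c : A) (Φ : A →L[𝕜] A →L[𝕜] 𝕜) (a b : A) :
    (bilinearFormBimodule 𝕜 A).left c Φ a b = Φ a (b * c) := rfl

theorem bilinearFormBimodule_right_apply (c : A) (Φ : A →L[𝕜] A →L[𝕜] 𝕜) (a b : A) :
    (bilinearFormBimodule 𝕜 A).right c Φ a b = Φ (c * a) b := rfl

end VirtualDiagonal

/-! ### From amenability to a virtual diagonal. -/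

section OfAmenable

namespace BanachBimodule

variable {𝕜 : Type*} [RCLike 𝕜] {A : Type*} [NonUnitalNormedRing A] [NormedSpace 𝕜 A]
  {E : Type*} [NormedAddCommGroup E] [NormedSpace 𝕜 E]

/-- The bounded bilinear map induced on the quotient by an invariant subspace. -/
noncomputable def quotientAction (N : Submodule 𝕜 E) [IsClosed (N : Set E)]
    (L : A →L[𝕜] E →L[𝕜] E) (h : ∀ a, ∀ x ∈ N, L a x ∈ N) : A →L[𝕜] (E ⧸ N) →L[𝕜] (E ⧸ N) :=
  (N.liftQL ((ContinuousLinearMap.compL 𝕜 E E (E ⧸ N) N.mkQL) ∘L L).flip (by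
    intro x hx
    rw [LinearMap.mem_ker]
    ext a
    simpa using h a x hx)).flip

theorem quotientAction_mk (N : Submodule 𝕜 E) [IsClosed (N : Set E)]
    (L : A →L[𝕜] E →L[𝕜] E) (h : ∀ a, ∀ x ∈ N, L a x ∈ N) (a : A) (x : E) :
    quotientAction N L h a (N.mkQ x) = N.mkQ (L a x) := rfl

/-- The quotient of a Banach bimodule by a closed invariant subspace. -/
noncomputable def quotient (M : BanachBimodule 𝕜 A E) (N : Submodule 𝕜 E) [IsClosed (N : Set E)]
    (hl : ∀ a, ∀ x ∈ N, M.left a x ∈ N) (hr : ∀ a, ∀ x ∈ N, M.right a x ∈ N) :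
    BanachBimodule 𝕜 A (E ⧸ N) where
  left := quotientAction N M.left hl
  right := quotientAction N M.right hr
  left_mul a b x := by
    obtain ⟨x, rfl⟩ := N.mkQ_surjective x
    simp only [quotientAction_mk, M.left_mul]
  right_mul a b x := by
    obtain ⟨x, rfl⟩ := N.mkQ_surjective x
    simp only [quotientAction_mk, M.right_mul]
  left_right a b x := by
    obtain ⟨x, rfl⟩ := N.mkQ_surjective x
    simp only [quotientAction_mk, M.left_right]

/-- An inner derivation `a ↦ a.f - f.a` into a dual bimodule. -/
noncomputable def innerDerivation (M : BanachBimodule 𝕜 A E) (f : StrongDual 𝕜 E) :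
    A →L[𝕜] StrongDual 𝕜 E :=
  M.dual.left.flip f - M.dual.right.flip f

theorem innerDerivation_apply (M : BanachBimodule 𝕜 A E) (f : StrongDual 𝕜 E) (a : A) (x : E) :
    M.innerDerivation f a x = f (M.right a x) - f (M.left a x) := rfl

theorem innerDerivation_isDerivation (M : BanachBimodule 𝕜 A E) (f : StrongDual 𝕜 E) :
    M.dual.IsDerivation (M.innerDerivation f) := by
  intro a b
  ext x
  rw [add_apply, M.dual_left_apply, M.dual_right_apply]
  simp [innerDerivation_apply, M.left_mul, M.right_mul, M.left_right]

end BanachBimodule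

variable {𝕜 : Type} [RCLike 𝕜] {A : Type u} [NonUnitalNormedRing A] [NormedSpace 𝕜 A]
    [IsScalarTower 𝕜 A A] [SMulCommClass 𝕜 A A] [CompleteSpace A]

/-- A functional which is balanced on an invariant subspace can be changed off the subspace to
one which is balanced everywhere. -/
theorem IsAmenable.exists_balanced_extension (hA : IsAmenable.{u, v} 𝕜 A) {E : Type v}
    [NormedAddCommGroup E] [NormedSpace 𝕜 E] [CompleteSpace E] (M : BanachBimodule 𝕜 A E)
    (N : Submodule 𝕜 E) (hl : ∀ a, ∀ x ∈ N, M.left a x ∈ N) (hr : ∀ a, ∀ x ∈ N, M.right a x ∈ N)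
    (f : StrongDual 𝕜 E) (hf : ∀ a, ∀ x ∈ N, f (M.right a x) = f (M.left a x)) :
    ∃ g : StrongDual 𝕜 E, (∀ x ∈ N, g x = f x) ∧ ∀ a x, g (M.right a x) = g (M.left a x) := by
  have hcl : ∀ L : E →L[𝕜] E, (∀ x ∈ N, L x ∈ N) →
      ∀ x ∈ N.topologicalClosure, L x ∈ N.topologicalClosure := fun L hL x hx =>
    map_mem_closure L.continuous hx hL
  have : IsClosed (N.topologicalClosure : Set E) := N.isClosed_topologicalClosure
  let Q := M.quotient N.topologicalClosure (fun a => hcl _ (hl a)) (fun a => hcl _ (hr a))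
  -- The inner derivation of `f` kills `N`, so it takes values in the dual of the quotient.
  -- Amenability makes it inner there, and subtracting that witness leaves `f` unchanged on `N`.
  let D : A →L[𝕜] StrongDual 𝕜 (E ⧸ N.topologicalClosure) :=
    (N.topologicalClosure.liftQL (M.innerDerivation f).flip (by
      refine N.topologicalClosure_minimal (fun x hx => ?_)
        (M.innerDerivation f).flip.isClosed_ker
      rw [LinearMap.mem_ker]
      ext a
      simp [M.innerDerivation_apply, hf a x hx])).flip
  have hD : ∀ a x, D a (N.topologicalClosure.mkQ x) = M.innerDerivation f a x := fun _ _ => rfl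
  obtain ⟨g, hg⟩ := hA _ Q D (by
    intro a b
    ext x
    obtain ⟨x, rfl⟩ := N.topologicalClosure.mkQ_surjective x
    rw [hD, M.innerDerivation_isDerivation f a b]
    rfl)
  refine ⟨f - g ∘L N.topologicalClosure.mkQL, fun x hx => ?_, fun a x => ?_⟩
  · have : N.topologicalClosure.mkQ x = 0 := by
      simpa using N.le_topologicalClosure hx
    simp [this]
  · have h1 : M.innerDerivation f a x = g (N.topologicalClosure.mkQ (M.right a x)) -
        g (N.topologicalClosure.mkQ (M.left a x)) := by
      rw [← hD, hg]
      rfl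
    rw [M.innerDerivation_apply] at h1
    simp only [sub_apply, ContinuousLinearMap.comp_apply, Submodule.mkQL_apply]
    linear_combination h1

/-- When one action on A* is zero, the inclusion of A in A** is a derivation, and a witness that it
is inner is a one-sided identity. -/
theorem IsAmenable.exists_left (hA : IsAmenable.{u, u} 𝕜 A) :
    ∃ m : StrongDual 𝕜 (StrongDual 𝕜 A), ∀ (ψ ψ' : StrongDual 𝕜 A) (c : A),
      (∀ a, ψ' a = ψ (c * a)) → m ψ' = ψ c := by
  let M : BanachBimodule 𝕜 A (StrongDual 𝕜 A) :=
    { left := 0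
      right := (ContinuousLinearMap.compL 𝕜 A A 𝕜).flip ∘L ContinuousLinearMap.mul 𝕜 A
      left_mul := by simp
      right_mul := fun a b ψ => by ext; simp [mul_assoc]
      left_right := by simp }
  obtain ⟨m, hm⟩ := hA _ M (NormedSpace.inclusionInDoubleDual 𝕜 A) (fun a b => by
    ext ψ
    rw [add_apply, M.dual_left_apply, M.dual_right_apply]
    simp [M])
  refine ⟨m, fun ψ ψ' c h => ?_⟩
  have h1 := congr($(hm c) ψ)
  rw [sub_apply, M.dual_left_apply, M.dual_right_apply] at h1
  have h2 : ψ' = M.right c ψ := by ext a; simp [M, h]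
  rw [h2]
  simpa [M] using h1.symm

theorem IsAmenable.exists_right (hA : IsAmenable.{u, u} 𝕜 A) :
    ∃ m : StrongDual 𝕜 (StrongDual 𝕜 A), ∀ (ψ ψ' : StrongDual 𝕜 A) (c : A),
      (∀ a, ψ' a = ψ (a * c)) → m ψ' = ψ c := by
  let M : BanachBimodule 𝕜 A (StrongDual 𝕜 A) :=
    { left := (ContinuousLinearMap.compL 𝕜 A A 𝕜).flip ∘L (ContinuousLinearMap.mul 𝕜 A).flip
      right := 0
      left_mul := fun a b ψ => by ext; simp [mul_assoc]
      right_mul := by simp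
      left_right := by simp }
  obtain ⟨m, hm⟩ := hA _ M (NormedSpace.inclusionInDoubleDual 𝕜 A) (fun a b => by
    ext ψ
    rw [add_apply, M.dual_left_apply, M.dual_right_apply]
    simp [M])
  -- Here the surviving action is the one subtracted in an inner derivation, hence the sign.
  refine ⟨-m, fun ψ ψ' c h => ?_⟩
  have h1 := congr($(hm c) ψ)
  rw [sub_apply, M.dual_left_apply, M.dual_right_apply] at h1
  have h2 : ψ' = M.left c ψ := by ext a; simp [M, h]
  rw [h2]
  simpa [M] using h1.symm

theorem IsAmenable.exists_isVirtualIdentity (hA : IsAmenable.{u, u} 𝕜 A) :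
    ∃ m : StrongDual 𝕜 (StrongDual 𝕜 A), IsVirtualIdentity m := by
  obtain ⟨m, hm⟩ := hA.exists_left
  obtain ⟨n, hn⟩ := hA.exists_right
  -- `q` is an Arens product of the two one-sided identities; the mixed identity is the classical e
  -- + f - ef.
  let q : StrongDual 𝕜 (StrongDual 𝕜 A) :=
    m ∘L (ContinuousLinearMap.compL 𝕜 A (StrongDual 𝕜 A) 𝕜 n) ∘L mulForm 𝕜 A
  have hq : ∀ ψ, q ψ = m (n ∘L mulForm 𝕜 A ψ) := fun _ => rfl
  refine ⟨m + n - q, fun ψ ψ' c h => ?_, fun ψ ψ' c h => ?_⟩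
  · have h1 : q ψ' = n ψ' := by
      have : n ψ' = (n ∘L mulForm 𝕜 A ψ) c := by
        rw [ContinuousLinearMap.comp_apply]
        congr 1
        ext a
        simp [h, mulForm_apply]
      rw [hq, this]
      refine hm _ _ c fun a => ?_
      simp only [ContinuousLinearMap.comp_apply]
      congr 1
      ext b
      simp [mulForm_apply, h, mul_assoc]
    simp [h1, hm ψ ψ' c h]
  · have h1 : q ψ' = m ψ' := by
      rw [hq]
      congr 1
      ext a
      rw [h]
      exact hn (mulForm 𝕜 A ψ a) _ c fun b => by simp [mulForm_apply, h, mul_assoc]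
    simp [h1, hn ψ ψ' c h]

theorem IsAmenable.exists_isVirtualDiagonal (hA : IsAmenable.{u, u} 𝕜 A) :
    ∃ M : StrongDual 𝕜 (A →L[𝕜] A →L[𝕜] 𝕜), IsVirtualDiagonal M := by
  obtain ⟨p, hp⟩ := hA.exists_isVirtualIdentity
  let B := bilinearFormBimodule 𝕜 A
  -- This is p ⊗ p. On the forms ψ(ab) it is already balanced, both sides being ψ(c); the extension
  -- result makes it balanced on all forms.
  let M₀ : StrongDual 𝕜 (A →L[𝕜] A →L[𝕜] 𝕜) := p ∘L ContinuousLinearMap.compL 𝕜 A (A →L[𝕜] 𝕜) 𝕜 p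
  have hM₀ : ∀ Φ, M₀ Φ = p (p ∘L Φ) := fun _ => rfl
  have hl : ∀ (ψ : StrongDual 𝕜 A) (Φ : A →L[𝕜] A →L[𝕜] 𝕜) (c : A),
      (∀ a b, Φ a b = ψ (c * a * b)) → M₀ Φ = ψ c := fun ψ Φ c h =>
    hp.comp_mul_left ψ _ c fun a => hp.comp_mul_left ψ _ (c * a) (h a)
  have hr : ∀ (ψ : StrongDual 𝕜 A) (Φ : A →L[𝕜] A →L[𝕜] 𝕜) (c : A),
      (∀ a b, Φ a b = ψ (a * b * c)) → M₀ Φ = ψ c := fun ψ Φ c h =>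
    hp.comp_mul_right ψ _ c fun a =>
      hp.comp_mul_right (ψ ∘L ContinuousLinearMap.mul 𝕜 A a) _ c fun b => by
        simp [h, mul_assoc]
  obtain ⟨M, hM, hMB⟩ := hA.exists_balanced_extension B
    (LinearMap.range (mulForm 𝕜 A : StrongDual 𝕜 A →ₗ[𝕜] A →L[𝕜] A →L[𝕜] 𝕜))
    (by
      rintro c _ ⟨ψ, rfl⟩
      refine ⟨ψ ∘L (ContinuousLinearMap.mul 𝕜 A).flip c, ?_⟩
      ext a b
      simp [B, bilinearFormBimodule_left_apply, mulForm_apply, mul_assoc])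
    (by
      rintro c _ ⟨ψ, rfl⟩
      refine ⟨ψ ∘L ContinuousLinearMap.mul 𝕜 A c, ?_⟩
      ext a b
      simp [B, bilinearFormBimodule_right_apply, mulForm_apply, mul_assoc])
    M₀
    (by
      rintro c _ ⟨ψ, rfl⟩
      rw [ContinuousLinearMap.coe_coe,
        hl ψ _ c fun a b => by simp [B, bilinearFormBimodule_right_apply, mulForm_apply],
        hr ψ _ c fun a b => by simp [B, bilinearFormBimodule_left_apply, mulForm_apply, mul_assoc]])
  refine ⟨M, fun Φ Φ₁ Φ₂ c h₁ h₂ => ?_, fun ψ Φ c h => ?_⟩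
  · have e₁ : Φ₁ = B.right c Φ := by ext a b; rw [h₁]; rfl
    have e₂ : Φ₂ = B.left c Φ := by ext a b; rw [h₂]; rfl
    rw [e₁, e₂, hMB]
  · rw [hM Φ, hl ψ Φ c h]
    refine ⟨ψ ∘L ContinuousLinearMap.mul 𝕜 A c, ?_⟩
    ext a b
    simp [mulForm_apply, h, mul_assoc]

end OfAmenable

/-! ### Transfer of a virtual diagonal from an algebra to a left ideal. -/

section Transfer

variable {𝕜 : Type*} [RCLike 𝕜]
  {A : Type*} [NonUnitalNormedRing A] [NormedSpace 𝕜 A]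
  {B : Type*} [NonUnitalNormedRing B] [NormedSpace 𝕜 B] [IsScalarTower 𝕜 B B]
  [SMulCommClass 𝕜 B B]

set_option maxSynthPendingDepth 4 in
/-- A virtual diagonal passes from `B` to an algebra `A` with a virtual identity whose opposite
is, through `θ`, a left ideal of `B`. -/
theorem IsVirtualDiagonal.of_leftIdeal [IsScalarTower 𝕜 A A] [SMulCommClass 𝕜 A A]
    {m : StrongDual 𝕜 (StrongDual 𝕜 A)}
    (hm : IsVirtualIdentity m) {M : StrongDual 𝕜 (B →L[𝕜] B →L[𝕜] 𝕜)} (hM : IsVirtualDiagonal M)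
    (θ : A → B) (hθ : Function.Injective θ) (hθm : ∀ a b, θ (a * b) = θ b * θ a)
    (L : B →L[𝕜] A →L[𝕜] A) (hL : ∀ b a, θ (L b a) = b * θ a) :
    ∃ M' : StrongDual 𝕜 (A →L[𝕜] A →L[𝕜] 𝕜), IsVirtualDiagonal M' := by
  have l₁ : ∀ c s b, c * L b s = L b (c * s) := fun c s b => hθ <| by simp [hL, hθm, mul_assoc]
  have l₂ : ∀ c s a, L a s * c = L (θ c * a) s := fun c s a => hθ <| by simp [hL, hθm, mul_assoc]
  have l₃ : ∀ c s b, L b (s * c) = L (b * θ c) s := fun c s b => hθ <| by simp [hL, hθm, mul_assoc]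
  have l₄ : ∀ d a b, L (a * b) d = L a (L b d) := fun d a b => hθ <| by simp [hL, mul_assoc]
  have l₅ : ∀ s c, L (θ c) s = s * c := fun s c => hθ <| by simp [hL, hθm]
  obtain ⟨C, hC⟩ : ∃ C : B →L[𝕜] StrongDual 𝕜 A →L[𝕜] 𝕜, ∀ b χ, C b χ = m (χ ∘L L b) :=
    ⟨(ContinuousLinearMap.compL 𝕜 _ _ 𝕜 m) ∘L (ContinuousLinearMap.compL 𝕜 A A 𝕜).flip ∘L L,
      fun _ _ => rfl⟩
  -- `T Φ a b` applies `m` in t, then in s, to Φ(L b s, L a t).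
  obtain ⟨T, hT⟩ : ∃ T : (A →L[𝕜] A →L[𝕜] 𝕜) →L[𝕜] B →L[𝕜] B →L[𝕜] 𝕜, ∀ Φ a b,
      T Φ a b = C b (C a ∘L Φ) :=
    ⟨(ContinuousLinearMap.compL 𝕜 B (StrongDual 𝕜 A) (B →L[𝕜] 𝕜) C.flip) ∘L
      ((ContinuousLinearMap.compL 𝕜 B (StrongDual 𝕜 A →L[𝕜] 𝕜) (StrongDual 𝕜 A)).flip C) ∘L
      (ContinuousLinearMap.compL 𝕜 A (StrongDual 𝕜 A) 𝕜).flip, fun _ _ _ => rfl⟩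
  refine ⟨M ∘L T, fun Φ Φ₁ Φ₂ c h₁ h₂ => ?_, fun ψ Φ c h => ?_⟩
  · refine (hM.balanced (T Φ) (T Φ₂) (T Φ₁) (θ c) (fun a b => ?_) (fun a b => ?_)).symm
    · rw [hT, hT]
      congr 1
      ext x
      rw [ContinuousLinearMap.comp_apply, ContinuousLinearMap.comp_apply, hC, hC]
      congr 1
      ext t
      simp [h₂, l₂]
    -- The mixed identity lets c pass from one side of s to the other: both sides reduce to the
    -- value at L b c.
    · rw [hT, hT, hC, hC, hm.comp_mul_left ((C a ∘L Φ) ∘L L b) _ c fun s => ?_,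
        hm.comp_mul_right ((C a ∘L Φ) ∘L L b) _ c fun s => ?_]
      · simp [l₃]
      · simp only [ContinuousLinearMap.comp_apply, ← l₁]
        congr 1
        ext y
        exact h₁ _ _
  · have h1 : ∀ a b, T Φ a b = ψ (L (a * b) c) := by
      intro a b
      rw [hT, hC]
      refine hm.comp_mul_left (ψ ∘L L (a * b)) _ c fun s => ?_
      simp only [ContinuousLinearMap.comp_apply]
      rw [hC, l₄]
      exact hm.comp_mul_left (ψ ∘L L a) _ (L b (c * s)) fun t => by simp [h, l₁]
    have h2 : ∀ b, C (b * θ c) ψ = ψ (L b c) := fun b => by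
      rw [hC]
      exact hm.comp_mul_right (ψ ∘L L b) _ c fun s => by simp [l₃]
    have h3 : C (θ c) ψ = ψ c := by
      rw [hC]
      exact hm.comp_mul_right ψ _ c fun s => by simp [l₅]
    rw [ContinuousLinearMap.comp_apply, ← h3, ← ContinuousLinearMap.flip_apply C,
      ← hM.isVirtualIdentity.comp_mul_right (C.flip ψ)
        (C.flip ψ ∘L (ContinuousLinearMap.mul 𝕜 B).flip (θ c)) (θ c) fun a => by simp,
      ContinuousLinearMap.comp_apply]
    congr 1
    ext a b
    simp [h1, mulForm_apply, ← h2]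

end Transfer

/-! ### Local reflexivity by finite nets and Hahn–Banach. -/

section LocalReflexivity

variable {𝕜 : Type*} [RCLike 𝕜]

/-- A linear functional which is dominated by the norm of a linear map `ω` factors through `ω`. -/
theorem exists_dual_comp_eq {V Y : Type*} [AddCommGroup V] [Module 𝕜 V] [NormedAddCommGroup Y]
    [NormedSpace 𝕜 Y] (ω : V →ₗ[𝕜] Y) (τ : V →ₗ[𝕜] 𝕜) {C : ℝ} (hC : 0 ≤ C)
    (h : ∀ v, ‖τ v‖ ≤ C * ‖ω v‖) : ∃ m : StrongDual 𝕜 Y, (∀ v, m (ω v) = τ v) ∧ ‖m‖ ≤ C := by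
  have hker : LinearMap.ker ω ≤ LinearMap.ker τ := fun v hv => by
    rw [LinearMap.mem_ker] at hv ⊢
    simpa [hv] using h v
  let t : LinearMap.range ω →ₗ[𝕜] 𝕜 :=
    (LinearMap.ker ω).liftQ τ hker ∘ₗ (ω.quotKerEquivRange.symm : _ →ₗ[𝕜] _)
  have ht : ∀ v, t ⟨ω v, v, rfl⟩ = τ v := fun v => by
    have : ω.quotKerEquivRange.symm ⟨ω v, v, rfl⟩ = (LinearMap.ker ω).mkQ v := by
      rw [LinearEquiv.symm_apply_eq]
      ext
      rfl
    simp only [t, LinearMap.comp_apply, LinearEquiv.coe_coe, this]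
    simp
  obtain ⟨m, hm, hmn⟩ := exists_extension_norm_eq (LinearMap.range ω) (t.mkContinuous C (by
    rintro ⟨_, v, rfl⟩
    rw [ht]
    exact h v))
  refine ⟨m, fun v => ?_, hmn ▸ LinearMap.mkContinuous_norm_le _ hC _⟩
  rw [← ht]
  exact hm ⟨ω v, v, rfl⟩

/-- Almost norming vectors, rotated so that each value is real and nonnegative, together form one
vector of sup norm at most 1. -/
theorem sum_norm_comp_single_le {κ X : Type*} [Fintype κ] [DecidableEq κ] [NormedAddCommGroup X]
    [NormedSpace 𝕜 X] (m : StrongDual 𝕜 (κ → X)) :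
    ∑ k, ‖m ∘L ContinuousLinearMap.single 𝕜 (fun _ : κ => X) k‖ ≤ ‖m‖ := by
  refine le_of_forall_pos_le_add fun ε hε => ?_
  obtain ⟨δ, hδ, hδε⟩ : ∃ δ : ℝ, 0 < δ ∧ Fintype.card κ * δ ≤ ε := by
    refine ⟨ε / (Fintype.card κ + 1), by positivity, ?_⟩
    rw [mul_div_assoc', div_le_iff₀ (by positivity)]
    nlinarith
  have hx : ∀ k, ∃ x : X, ‖x‖ ≤ 1 ∧ ∃ r : ℝ, m (Pi.single k x) = r ∧
      ‖m ∘L ContinuousLinearMap.single 𝕜 (fun _ : κ => X) k‖ - δ ≤ r := by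
    intro k
    obtain ⟨x, hx, hr⟩ := ContinuousLinearMap.exists_lt_apply_of_lt_opNorm
      (m ∘L ContinuousLinearMap.single 𝕜 (fun _ : κ => X) k) (sub_lt_self _ hδ)
    obtain ⟨c, hc, hcx⟩ := RCLike.exists_norm_eq_mul_self (m (Pi.single k x))
    refine ⟨c • x, by rw [norm_smul, hc, one_mul]; exact hx.le, ‖m (Pi.single k x)‖, ?_, hr.le⟩
    rw [Pi.single_smul, map_smul, smul_eq_mul, ← hcx]
  choose x hx r hr hle using hx
  have h1 : m x = ((∑ k, r k : ℝ) : 𝕜) := by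
    rw [← Finset.univ_sum_single x, map_sum]
    simp [hr]
  have h2 : ∑ k, r k ≤ ‖m‖ := by
    calc ∑ k, r k ≤ ‖m x‖ := by rw [h1, RCLike.norm_ofReal]; exact le_abs_self _
      _ ≤ ‖m‖ * ‖x‖ := m.le_opNorm x
      _ ≤ ‖m‖ * 1 := by
        gcongr
        exact (pi_norm_le_iff_of_nonneg zero_le_one).2 hx
      _ = ‖m‖ := mul_one _
  have h3 := Finset.sum_le_sum fun k (_ : k ∈ Finset.univ) => hle k
  rw [Finset.sum_sub_distrib, Finset.sum_const, Finset.card_univ, nsmul_eq_mul] at h3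
  linarith

/-- A finite set of vectors in the unit ball of a finite dimensional space which computes operator
norms up to a factor `2`. -/
theorem exists_finset_opNorm_le (𝕜 : Type*) [RCLike 𝕜] (G : Type*) [NormedAddCommGroup G]
    [NormedSpace 𝕜 G] [FiniteDimensional 𝕜 G] :
    ∃ s : Finset G, (∀ h ∈ s, ‖h‖ ≤ 1) ∧ ∀ {X : Type v} [NormedAddCommGroup X] [NormedSpace 𝕜 X]
      (p : G →L[𝕜] X) (r : ℝ), 0 ≤ r → (∀ h ∈ s, ‖p h‖ ≤ r) → ‖p‖ ≤ 2 * r := by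
  have : ProperSpace G := FiniteDimensional.proper 𝕜 G
  obtain ⟨t, hts, htf, ht⟩ := (isCompact_closedBall (0 : G) 1).finite_cover_balls
    (show (0 : ℝ) < 1 / 2 by norm_num)
  refine ⟨htf.toFinset, fun h hh => by simpa using hts (htf.mem_toFinset.1 hh), ?_⟩
  intro X _ _ p r hr hp
  -- The set is a 1/2-net of the unit ball, so the error term is absorbed on the left.
  have : ‖p‖ ≤ r + ‖p‖ * (1 / 2) := by
    let _ : NormedSpace ℝ G := NormedSpace.restrictScalars ℝ 𝕜 G
    refine ContinuousLinearMap.opNorm_le_of_unit_norm (by positivity) fun v hv => ?_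
    obtain ⟨h, hh, hvh⟩ := Set.mem_iUnion₂.1 (ht (show v ∈ Metric.closedBall (0 : G) 1 by
      simp [hv]))
    have h1 : ‖p v‖ ≤ ‖p h‖ + ‖p (v - h)‖ := by
      rw [map_sub]; exact norm_le_norm_add_norm_sub' _ _
    have h2 : ‖v - h‖ ≤ 1 / 2 := by
      rw [← dist_eq_norm]; exact (Metric.mem_ball.1 hvh).le
    have h3 := hp h (htf.mem_toFinset.2 hh)
    have h4 := p.le_of_opNorm_le_of_le le_rfl h2
    linarith
  linarith

/-- A form of local reflexivity: a functional on the operators `G → X` which is given by a tensor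
in `X* ⊗ G`, with `G` a finite dimensional space mapped into `X**` by a contraction, controls the trace of the tensor. -/
theorem norm_sum_apply_le_of_forall_norm_le {X : Type*} [NormedAddCommGroup X] [NormedSpace 𝕜 X]
    {G : Type*} [NormedAddCommGroup G] [NormedSpace 𝕜 G] [FiniteDimensional 𝕜 G]
    (J : G →ₗ[𝕜] StrongDual 𝕜 (StrongDual 𝕜 X)) (hJ : ∀ w, ‖J w‖ ≤ ‖w‖) {ι : Type*}
    (s : Finset ι) (f : ι → StrongDual 𝕜 X) (g : ι → G) {K : ℝ} (hK : 0 ≤ K)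
    (h : ∀ p : G →L[𝕜] X, ‖∑ i ∈ s, f i (p (g i))‖ ≤ K * ‖p‖) :
    ‖∑ i ∈ s, J (g i) (f i)‖ ≤ 2 * K := by
  classical
  obtain ⟨t, ht, htp⟩ := exists_finset_opNorm_le 𝕜 G
  let ω : (G →L[𝕜] X) →ₗ[𝕜] (t → X) :=
    LinearMap.pi fun k => (ContinuousLinearMap.apply 𝕜 X (k : G)).toLinearMap
  let τ : (G →L[𝕜] X) →ₗ[𝕜] 𝕜 :=
    ∑ i ∈ s, (f i ∘L ContinuousLinearMap.apply 𝕜 X (g i)).toLinearMap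
  have hω : ∀ p k, ω p k = p k := fun _ _ => rfl
  have hτ : ∀ p, τ p = ∑ i ∈ s, f i (p (g i)) := fun p => by simp [τ]
  -- Evaluation on the net embeds the operators into a finite sup-sum of copies of X, with norm loss
  -- 2. The extended functional splits into the `x'` below, of total norm at most 2K.
  obtain ⟨m, hm, hmK⟩ := exists_dual_comp_eq ω τ (C := 2 * K) (by positivity) fun p => by
    rw [hτ]
    have h1 := htp p ‖ω p‖ (norm_nonneg _) fun h hh => norm_le_pi_norm (ω p) ⟨h, hh⟩
    nlinarith [h p]
  let x' : t → StrongDual 𝕜 X := fun k => m ∘L ContinuousLinearMap.single 𝕜 (fun _ : t => X) k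
  have hmx : ∀ x : t → X, m x = ∑ k, x' k (x k) := fun x => by
    conv_lhs => rw [← Finset.univ_sum_single x, map_sum]
    rfl
  -- Testing on rank one operators shows that Σ f_i ⊗ g_i and Σ x'_k ⊗ k are the same tensor, so
  -- their traces agree.
  have key : ∀ l : StrongDual 𝕜 G, ∑ i ∈ s, l (g i) • f i = ∑ k : t, l k • x' k := by
    intro l
    ext x
    have h1 := hm (l.smulRight x)
    rw [hτ, hmx] at h1
    simpa [hω] using h1.symm
  let b := Module.finBasis 𝕜 G
  have hb : ∀ w : G, ∀ e : StrongDual 𝕜 X, J w e =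
      ∑ j, J (b j) ((b.coord j).toContinuousLinearMap w • e) := by
    intro w e
    have h1 := congr(J $(b.sum_repr w) e)
    rw [map_sum, sum_apply] at h1
    rw [← h1]
    simp
  have h2 : ∑ i ∈ s, J (g i) (f i) =
      ∑ k : t, J k (x' k) := by
    rw [Finset.sum_congr rfl fun i _ => hb (g i) (f i),
      Finset.sum_congr rfl fun (k : t) _ => hb k (x' k), Finset.sum_comm, Finset.sum_comm (γ := t)]
    refine Finset.sum_congr rfl fun j _ => ?_
    rw [← map_sum, ← map_sum, key]
  calc _ = ‖∑ k : t, J k (x' k)‖ := by rw [h2]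
    _ ≤ ∑ k : t, ‖x' k‖ := norm_sum_le_of_le _ fun k _ => by
      simpa using (J k).le_of_opNorm_le ((hJ k).trans (ht k k.2)) (x' k)
    _ ≤ ‖m‖ := sum_norm_comp_single_le m
    _ ≤ 2 * K := hmK

end LocalReflexivity

/-! ### Finite rank operators and their adjoints. -/

section DualAmenability

set_option maxSynthPendingDepth 4

section FiniteRank

variable {𝕜 : Type*} [RCLike 𝕜] {X : Type*} [NormedAddCommGroup X] [NormedSpace 𝕜 X]

/-- The adjoint operator `f ↦ f ∘ S`, as a bounded linear map. -/
noncomputable def adjointL (𝕜 : Type*) [RCLike 𝕜] (X : Type*) [NormedAddCommGroup X]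
    [NormedSpace 𝕜 X] : (X →L[𝕜] X) →L[𝕜] (StrongDual 𝕜 X →L[𝕜] StrongDual 𝕜 X) :=
  (ContinuousLinearMap.compL 𝕜 X X 𝕜).flip

theorem adjointL_apply (S : X →L[𝕜] X) (f : StrongDual 𝕜 X) : adjointL 𝕜 X S f = f ∘L S := rfl

theorem norm_adjointL (S : X →L[𝕜] X) : ‖adjointL 𝕜 X S‖ = ‖S‖ := by
  refine le_antisymm ?_ ?_
  · refine ContinuousLinearMap.opNorm_le_bound (adjointL 𝕜 X S) (norm_nonneg S) fun f => ?_
    rw [mul_comm]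
    exact f.opNorm_comp_le S
  · refine S.opNorm_le_bound (norm_nonneg (adjointL 𝕜 X S)) fun x => ?_
    obtain ⟨f, hf, hfx⟩ := exists_dual_vector'' 𝕜 (S x)
    calc ‖S x‖ = ‖adjointL 𝕜 X S f x‖ := by rw [adjointL_apply]; simp [hfx]
      _ ≤ ‖adjointL 𝕜 X S‖ * 1 * ‖x‖ :=
        ContinuousLinearMap.le_of_opNorm_le _ (ContinuousLinearMap.le_opNorm_of_le _ hf) x
      _ = _ := by rw [mul_one]

theorem mem_finiteRankOperators_iff {T : X →L[𝕜] X} : T ∈ finiteRankOperators 𝕜 X ↔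
    ∃ (n : ℕ) (f : Fin n → StrongDual 𝕜 X) (y : Fin n → X), T = ∑ i, (f i).smulRight (y i) := by
  constructor
  · intro hT
    have : FiniteDimensional 𝕜 (LinearMap.range (T : X →ₗ[𝕜] X)) := hT
    let b := Module.finBasis 𝕜 (LinearMap.range (T : X →ₗ[𝕜] X))
    refine ⟨_, fun i => (b.coord i).toContinuousLinearMap ∘L
      T.codRestrict (LinearMap.range (T : X →ₗ[𝕜] X)) (fun x => ⟨x, rfl⟩), fun i => b i, ?_⟩
    ext x
    have h1 := congrArg Subtype.val (b.sum_repr ⟨T x, x, rfl⟩)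
    rw [Submodule.coe_sum] at h1
    rw [sum_apply]
    exact h1.symm
  · rintro ⟨n, f, y, rfl⟩
    refine sum_mem fun i _ => ?_
    change FiniteDimensional 𝕜 (LinearMap.range ((f i).smulRight (y i) : X →ₗ[𝕜] X))
    refine Submodule.finiteDimensional_of_le (S₂ := Submodule.span 𝕜 {y i}) ?_
    rintro _ ⟨x, rfl⟩
    exact Submodule.smul_mem _ _ (Submodule.mem_span_singleton_self _)

theorem smulRight_mem_finiteRankOperators (f : StrongDual 𝕜 X) (y : X) :
    f.smulRight y ∈ finiteRankOperators 𝕜 X :=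
  mem_finiteRankOperators_iff.2 ⟨1, fun _ => f, fun _ => y, by simp⟩

theorem exists_adjointL_eq_comp {S : X →L[𝕜] X} (hS : S ∈ finiteRankOperators 𝕜 X)
    (b : StrongDual 𝕜 X →L[𝕜] StrongDual 𝕜 X) :
    ∃ S' ∈ finiteRankOperators 𝕜 X, adjointL 𝕜 X S' = b ∘L adjointL 𝕜 X S := by
  obtain ⟨n, f, y, rfl⟩ := mem_finiteRankOperators_iff.1 hS
  refine ⟨∑ i, (b (f i)).smulRight (y i), mem_finiteRankOperators_iff.2 ⟨n, _, _, rfl⟩, ?_⟩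
  ext g x
  have h1 : g ∘L ∑ i, (f i).smulRight (y i) = ∑ i, g (y i) • f i := by
    ext x; simp [mul_comm]
  rw [ContinuousLinearMap.comp_apply, adjointL_apply, adjointL_apply, h1]
  simp [mul_comm]

theorem adjointL_mem_finiteRankOperators {S : X →L[𝕜] X} (hS : S ∈ finiteRankOperators 𝕜 X) :
    adjointL 𝕜 X S ∈ finiteRankOperators 𝕜 (StrongDual 𝕜 X) := by
  obtain ⟨n, f, y, rfl⟩ := mem_finiteRankOperators_iff.1 hS
  refine mem_finiteRankOperators_iff.2
    ⟨n, fun i => NormedSpace.inclusionInDoubleDual 𝕜 X (y i), f, ?_⟩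
  ext g x
  simp [adjointL_apply, mul_comm]

end FiniteRank

section Lift

variable {𝕜 : Type*} [RCLike 𝕜] {A Z Y W : Type*} [NormedAddCommGroup A] [NormedSpace 𝕜 A]
  [NormedAddCommGroup Z] [NormedSpace 𝕜 Z] [NormedAddCommGroup Y] [NormedSpace 𝕜 Y]
  [NormedAddCommGroup W] [NormedSpace 𝕜 W]

/-- A bounded bilinear map with values in the range of an isometry lifts through the isometry. -/
theorem LinearIsometry.exists_lift_bilinear (i : A →ₗᵢ[𝕜] Z) (F : Y →L[𝕜] W →L[𝕜] Z)
    (h : ∀ y w, ∃ a, i a = F y w) : ∃ L : Y →L[𝕜] W →L[𝕜] A, ∀ y w, i (L y w) = F y w := by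
  choose L hL using h
  refine ⟨LinearMap.mkContinuous₂ (LinearMap.mk₂ 𝕜 L
    (fun y y' w => i.injective (by simp [hL])) (fun c y w => i.injective (by simp [hL]))
    (fun y w w' => i.injective (by simp [hL])) (fun c y w => i.injective (by simp [hL]))) ‖F‖
    (fun y w => ?_), hL⟩
  rw [LinearMap.mk₂_apply, ← i.norm_map, hL]
  exact F.le_opNorm₂ y w

end Lift

/-! ### Virtual identities of algebras of approximable operators. -/

section ApproximableAlgebra

variable {𝕜 : Type*} [RCLike 𝕜]

/-- The isometry `i` identifies `A` with the algebra of approximable operators on `X`. -/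
structure IsApproximableAlgebra {A X : Type*} [NonUnitalNormedRing A] [NormedSpace 𝕜 A]
    [NormedAddCommGroup X] [NormedSpace 𝕜 X] (i : A →ₗᵢ[𝕜] (X →L[𝕜] X)) : Prop where
  map_mul : ∀ a b, i (a * b) = i a ∘L i b
  range_eq : Set.range i = closure (finiteRankOperators 𝕜 X : Set (X →L[𝕜] X))

namespace IsApproximableAlgebra

variable {A X : Type*} [NonUnitalNormedRing A] [NormedSpace 𝕜 A]
  [NormedAddCommGroup X] [NormedSpace 𝕜 X] {i : A →ₗᵢ[𝕜] (X →L[𝕜] X)}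

theorem exists_eq (hi : IsApproximableAlgebra i) {T : X →L[𝕜] X}
    (hT : T ∈ finiteRankOperators 𝕜 X) : ∃ a, i a = T := by
  have : T ∈ Set.range i := hi.range_eq ▸ subset_closure hT
  exact this

theorem dense (hi : IsApproximableAlgebra i) : Dense {a : A | i a ∈ finiteRankOperators 𝕜 X} := by
  intro a
  have h1 : Set.range i ⊆ closure (i '' {a : A | i a ∈ finiteRankOperators 𝕜 X}) := by
    rw [hi.range_eq]
    refine closure_mono fun T hT => ?_
    obtain ⟨a, rfl⟩ := hi.exists_eq hT
    exact ⟨a, hT, rfl⟩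
  rw [i.isometry.isUniformInducing.isInducing.closure_eq_preimage_closure_image]
  exact h1 ⟨a, rfl⟩

theorem exists_rankOne (hi : IsApproximableAlgebra i) :
    ∃ R : StrongDual 𝕜 X →L[𝕜] X →L[𝕜] A, ∀ f y, i (R f y) = f.smulRight y :=
  i.exists_lift_bilinear (ContinuousLinearMap.smulRightL 𝕜 X X) fun f y =>
    hi.exists_eq (smulRight_mem_finiteRankOperators f y)

theorem clm_ext (hi : IsApproximableAlgebra i) {Z : Type*} [NormedAddCommGroup Z]
    [NormedSpace 𝕜 Z] {R : StrongDual 𝕜 X →L[𝕜] X →L[𝕜] A}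
    (hR : ∀ f y, i (R f y) = f.smulRight y) {φ ψ : A →L[𝕜] Z}
    (h : ∀ f y, φ (R f y) = ψ (R f y)) : φ = ψ := by
  refine ContinuousLinearMap.coeFn_injective
    (Continuous.ext_on hi.dense φ.continuous ψ.continuous fun a ha => ?_)
  obtain ⟨n, f, y, ha⟩ := mem_finiteRankOperators_iff.1 ha
  have : a = ∑ j, R (f j) (y j) := i.injective (by simp only [ha, map_sum, hR])
  rw [this, map_sum, map_sum]
  exact Finset.sum_congr rfl fun j _ => h _ _

/-- The functional `a ↦ ξ (f ∘ a)`. -/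
noncomputable def adjointCoefficient (i : A →ₗᵢ[𝕜] (X →L[𝕜] X))
    (ξ : StrongDual 𝕜 (StrongDual 𝕜 X)) (f : StrongDual 𝕜 X) : StrongDual 𝕜 A :=
  ξ ∘L ContinuousLinearMap.compL 𝕜 X X 𝕜 f ∘L i.toContinuousLinearMap

theorem adjointCoefficient_apply (ξ : StrongDual 𝕜 (StrongDual 𝕜 X)) (f : StrongDual 𝕜 X)
    (a : A) : adjointCoefficient i ξ f a = ξ (f ∘L i a) := rfl

/-- The functional `a ↦ ξ (a f)`. -/
noncomputable def coefficient (i : A →ₗᵢ[𝕜] (X →L[𝕜] X)) (ξ : StrongDual 𝕜 X) (f : X) :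
    StrongDual 𝕜 A :=
  ξ ∘L ContinuousLinearMap.apply 𝕜 X f ∘L i.toContinuousLinearMap

theorem coefficient_apply (ξ : StrongDual 𝕜 X) (f : X) (a : A) :
    coefficient i ξ f a = ξ (i a f) := rfl

/-- If η(f) = 1, then a f = (a (η ⊗ f)) f, so the right identity applies. -/
theorem apply_coefficient (hi : IsApproximableAlgebra i) {n : StrongDual 𝕜 (StrongDual 𝕜 A)}
    (hn : IsVirtualIdentity n) (ξ : StrongDual 𝕜 X) (f : X) : n (coefficient i ξ f) = ξ f := by
  obtain ⟨R, hR⟩ := hi.exists_rankOne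
  by_cases hf : f = 0
  · have : coefficient i ξ f = 0 := by ext S; simp [coefficient_apply, hf]
    rw [this, hf, map_zero, map_zero]
  · obtain ⟨η, hη⟩ := SeparatingDual.exists_eq_one (R := 𝕜) hf
    rw [hn.comp_mul_right (coefficient i ξ f) _ (R η f) fun T => ?_]
    · simp [coefficient_apply, hR, hη]
    · simp [coefficient_apply, hi.map_mul, hR, hη]

variable [IsScalarTower 𝕜 A A] [SMulCommClass 𝕜 A A]

/-- For a rank one c = f ⊗ y, both ψ(c a) and ψ(a c) are adjoint coefficients in a, as (f ⊗ y) a =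
(f ∘ a) ⊗ y and a (f ⊗ y) = f ⊗ a y. Density of finite rank operators gives all c. -/
theorem isVirtualIdentity_of_apply_adjointCoefficient (hi : IsApproximableAlgebra i)
    {m : StrongDual 𝕜 (StrongDual 𝕜 A)} (hm : ∀ ξ f, m (adjointCoefficient i ξ f) = ξ f) :
    IsVirtualIdentity m := by
  obtain ⟨R, hR⟩ := hi.exists_rankOne
  refine ⟨fun ψ ψ' c h => ?_, fun ψ ψ' c h => ?_⟩
  · have h1 : m ∘L ContinuousLinearMap.compL 𝕜 A A 𝕜 ψ ∘L ContinuousLinearMap.mul 𝕜 A = ψ := by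
      refine hi.clm_ext hR fun f y => ?_
      have h2 : ψ ∘L ContinuousLinearMap.mul 𝕜 A (R f y) =
          adjointCoefficient i (ψ ∘L R.flip y) f := by
        ext a
        change ψ (R f y * a) = ψ (R (f ∘L i a) y)
        congr 1
        refine i.injective ?_
        ext x
        simp [hi.map_mul, hR]
      change m (ψ ∘L ContinuousLinearMap.mul 𝕜 A (R f y)) = _
      rw [h2, hm]
      rfl
    have h3 : ψ' = ψ ∘L ContinuousLinearMap.mul 𝕜 A c := by ext a; exact h a
    rw [h3]
    exact congr($h1 c)
  · have h1 : m ∘L ContinuousLinearMap.compL 𝕜 A A 𝕜 ψ ∘L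
        (ContinuousLinearMap.mul 𝕜 A).flip = ψ := by
      refine hi.clm_ext hR fun f y => ?_
      have h2 : ψ ∘L (ContinuousLinearMap.mul 𝕜 A).flip (R f y) =
          adjointCoefficient i (NormedSpace.inclusionInDoubleDual 𝕜 X y) (ψ ∘L R f) := by
        ext a
        change ψ (a * R f y) = ψ (R f (i a y))
        congr 1
        refine i.injective ?_
        ext x
        simp [hi.map_mul, hR]
      change m (ψ ∘L (ContinuousLinearMap.mul 𝕜 A).flip (R f y)) = _
      rw [h2, hm]
      rfl
    have h3 : ψ' = ψ ∘L (ContinuousLinearMap.mul 𝕜 A).flip c := by ext a; exact h a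
    rw [h3]
    exact congr($h1 c)

end IsApproximableAlgebra

end ApproximableAlgebra

/-! ### Comparing the algebras on X and on X*. -/

section Dual

open IsApproximableAlgebra

variable {𝕜 : Type*} [RCLike 𝕜] {X A B : Type*} [NormedAddCommGroup X] [NormedSpace 𝕜 X]
  [NonUnitalNormedRing A] [NormedSpace 𝕜 A] {i : A →ₗᵢ[𝕜] (X →L[𝕜] X)}
  [NonUnitalNormedRing B] [NormedSpace 𝕜 B]
  {j : B →ₗᵢ[𝕜] (StrongDual 𝕜 X →L[𝕜] StrongDual 𝕜 X)}

/-- The vectors ξ ∘ T lie in a finite dimensional G ⊆ X**. Each p : G → X turns T into the finite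
rank operator S x = p(x ∘ T) on X, x being viewed in X**, with ‖S‖ ≤ ‖T‖‖p‖ and ξ(f ∘ S) = f(p(ξ ∘
T)). Local reflexivity then replaces p by the inclusion of G. -/
theorem IsApproximableAlgebra.norm_sum_coefficient_apply_le (hi : IsApproximableAlgebra i)
    {ι : Type*} (s : Finset ι)
    (ξ : ι → StrongDual 𝕜 (StrongDual 𝕜 X)) (f : ι → StrongDual 𝕜 X)
    {T : StrongDual 𝕜 X →L[𝕜] StrongDual 𝕜 X}
    (hT : T ∈ finiteRankOperators 𝕜 (StrongDual 𝕜 X)) :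
    ‖∑ k ∈ s, ξ k (T (f k))‖ ≤ 2 * ‖∑ k ∈ s, adjointCoefficient i (ξ k) (f k)‖ * ‖T‖ := by
  obtain ⟨n, η, e, hTe⟩ := mem_finiteRankOperators_iff.1 hT
  let G := Submodule.span 𝕜 (Set.range η)
  have hmem : ∀ ζ : StrongDual 𝕜 (StrongDual 𝕜 X), ζ ∘L T ∈ G := fun ζ => by
    have : ζ ∘L T = ∑ j, ζ (e j) • η j := by
      ext g
      simp [hTe, mul_comm]
    rw [this]
    exact sum_mem fun j _ => Submodule.smul_mem _ _ (Submodule.subset_span ⟨j, rfl⟩)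
  have : FiniteDimensional 𝕜 G := FiniteDimensional.span_of_finite 𝕜 (Set.finite_range η)
  rw [mul_assoc]
  refine norm_sum_apply_le_of_forall_norm_le G.subtype (fun _ => le_rfl) s f
    (fun i => ⟨ξ i ∘L T, hmem (ξ i)⟩) (by positivity) fun p => ?_
  let η' : Fin n → G := fun j => ⟨η j, Submodule.subset_span ⟨j, rfl⟩⟩
  have hmk : ∀ ζ : StrongDual 𝕜 (StrongDual 𝕜 X),
      (⟨ζ ∘L T, hmem ζ⟩ : G) = ∑ j, ζ (e j) • η' j := fun ζ => by
    ext g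
    simp [hTe, mul_comm, η']
  let S : X →L[𝕜] X := ∑ j, (e j).smulRight (p (η' j))
  have hS : S ∈ finiteRankOperators 𝕜 X := mem_finiteRankOperators_iff.2 ⟨n, _, _, rfl⟩
  obtain ⟨a, ha⟩ := hi.exists_eq hS
  have hSn : ‖S‖ ≤ ‖T‖ * ‖p‖ := by
    refine ContinuousLinearMap.opNorm_le_bound _ (by positivity) fun x => ?_
    have h1 : S x = p ⟨NormedSpace.inclusionInDoubleDual 𝕜 X x ∘L T, hmem _⟩ := by
      rw [hmk]
      simp [S]
    have h2 : ‖(⟨NormedSpace.inclusionInDoubleDual 𝕜 X x ∘L T, hmem _⟩ : G)‖ ≤ ‖x‖ * ‖T‖ :=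
      (ContinuousLinearMap.opNorm_comp_le _ _).trans (mul_le_mul_of_nonneg_right
        (NormedSpace.double_dual_bound 𝕜 X x) (norm_nonneg _))
    rw [h1]
    exact (p.le_opNorm_of_le h2).trans_eq (by ring)
  have h3 : ∀ i, f i (p ⟨ξ i ∘L T, hmem (ξ i)⟩) = ξ i (f i ∘L S) := fun i => by
    have : f i ∘L S = ∑ j, f i (p (η' j)) • e j := by
      ext x
      simp [S, mul_comm]
    rw [this, hmk]
    simp [mul_comm]
  have h4 := ContinuousLinearMap.le_of_opNorm_le_of_le
    (∑ k ∈ s, adjointCoefficient i (ξ k) (f k)) le_rfl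
    (show ‖a‖ ≤ ‖T‖ * ‖p‖ by rw [← i.norm_map, ha]; exact hSn)
  simp only [sum_apply, adjointCoefficient_apply, ha] at h4
  simp only [h3]
  rw [mul_assoc]
  exact h4

theorem IsApproximableAlgebra.exists_isVirtualIdentity [IsScalarTower 𝕜 A A]
    [SMulCommClass 𝕜 A A] (hi : IsApproximableAlgebra i) (hj : IsApproximableAlgebra j)
    {n : StrongDual 𝕜 (StrongDual 𝕜 B)}
    (hn : IsVirtualIdentity n) :
    ∃ m : StrongDual 𝕜 (StrongDual 𝕜 A), IsVirtualIdentity m := by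
  -- Formal combinations of pairs (ξ, f) avoid choosing representations: `ω` and `ω'` realise them
  -- over A and B, and `τ` is the prescribed value.
  let ω : ((StrongDual 𝕜 (StrongDual 𝕜 X) × StrongDual 𝕜 X) →₀ 𝕜) →ₗ[𝕜]
    StrongDual 𝕜 A :=
    Finsupp.linearCombination 𝕜 fun k => adjointCoefficient i k.1 k.2
  let ω' : ((StrongDual 𝕜 (StrongDual 𝕜 X) × StrongDual 𝕜 X) →₀ 𝕜) →ₗ[𝕜]
    StrongDual 𝕜 B :=
    Finsupp.linearCombination 𝕜 fun k => coefficient j k.1 k.2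
  let τ : ((StrongDual 𝕜 (StrongDual 𝕜 X) × StrongDual 𝕜 X) →₀ 𝕜) →ₗ[𝕜] 𝕜 := Finsupp.linearCombination 𝕜 fun i => i.1 i.2
  have hτ : ∀ v, τ v = n (ω' v) := fun v => by
    simp only [τ, ω', Finsupp.linearCombination_apply, Finsupp.sum, map_sum, map_smul,
      hj.apply_coefficient hn]
  have hω' : ∀ v, ‖ω' v‖ ≤ 2 * ‖ω v‖ := fun v => by
    refine ContinuousLinearMap.opNorm_le_bound _ (by positivity) fun T => ?_
    refine hj.dense.induction (P := fun T => ‖ω' v T‖ ≤ 2 * ‖ω v‖ * ‖T‖)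
      (fun T hT => ?_) (isClosed_le (by fun_prop) (by fun_prop)) T
    have h1 := hi.norm_sum_coefficient_apply_le v.support (fun i => v i • i.1) (fun i => i.2) hT
    have h2 : ω v = ∑ k ∈ v.support, adjointCoefficient i (v k • k.1) k.2 := by
      simp only [ω, Finsupp.linearCombination_apply, Finsupp.sum]
      rfl
    have h3 : ω' v T = ∑ k ∈ v.support, (v k • k.1) (j T k.2) := by
      simp only [ω', Finsupp.linearCombination_apply, Finsupp.sum, sum_apply]
      rfl
    rw [h2, h3]
    rw [j.norm_map] at h1
    exact h1
  obtain ⟨m, hm, -⟩ := exists_dual_comp_eq ω τ (C := ‖n‖ * 2) (by positivity) fun v => by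
    rw [hτ, mul_assoc]
    exact n.le_opNorm_of_le (hω' v)
  refine ⟨m, hi.isVirtualIdentity_of_apply_adjointCoefficient fun ξ f => ?_⟩
  simpa [ω, τ] using hm (Finsupp.single (ξ, f) 1)

theorem IsApproximableAlgebra.exists_adjointL_eq (hi : IsApproximableAlgebra i)
    (hj : IsApproximableAlgebra j) (a : A) : ∃ b, j b = adjointL 𝕜 X (i a) := by
  have h1 : i a ∈ closure (finiteRankOperators 𝕜 X : Set (X →L[𝕜] X)) := hi.range_eq ▸ ⟨a, rfl⟩
  have h2 := map_mem_closure (adjointL 𝕜 X).continuous h1 fun T hT =>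
    adjointL_mem_finiteRankOperators hT
  rw [← hj.range_eq] at h2
  exact h2

/-- The approximable operators on `X` form, through the adjoint, a left ideal of the approximable
operators on `X*`: the operator `L b a` has the adjoint `b ∘ a*`. -/
theorem IsApproximableAlgebra.exists_leftIdeal_action [CompleteSpace A]
    (hi : IsApproximableAlgebra i) : ∃ L : B →L[𝕜] A →L[𝕜] A,
      ∀ b a, adjointL 𝕜 X (i (L b a)) = j b ∘L adjointL 𝕜 X (i a) := by
  let i' : A →ₗᵢ[𝕜] (StrongDual 𝕜 X →L[𝕜] StrongDual 𝕜 X) :=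
    { (adjointL 𝕜 X ∘L i.toContinuousLinearMap).toLinearMap with
      norm_map' := fun a => (norm_adjointL (i a)).trans (i.norm_map a) }
  refine i'.exists_lift_bilinear ((ContinuousLinearMap.compL 𝕜 (StrongDual 𝕜 X) (StrongDual 𝕜 X)
    (StrongDual 𝕜 X)).bilinearComp j.toContinuousLinearMap i'.toContinuousLinearMap) fun b a => ?_
  -- Completeness of A makes the isometric image closed, so the finite rank case passes to the
  -- limit.
  have hcl : IsClosed (Set.range i') := i'.isometry.isClosedEmbedding.isClosed_range
  refine hi.dense.induction (P := fun a => j b ∘L i' a ∈ Set.range i') (fun a ha => ?_)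
    (hcl.preimage ((ContinuousLinearMap.compL 𝕜 _ _ _ (j b)) ∘L
      i'.toContinuousLinearMap).continuous) a
  obtain ⟨S, hS, hSb⟩ := exists_adjointL_eq_comp ha (j b)
  obtain ⟨a', rfl⟩ := hi.exists_eq hS
  exact ⟨a', hSb⟩

end Dual

theorem IsApproximableAlgebra.isAmenable_of_dual {𝕜 : Type} [RCLike 𝕜] {X A B : Type u}
    [NormedAddCommGroup X] [NormedSpace 𝕜 X]
    [NonUnitalNormedRing A] [NormedSpace 𝕜 A] [IsScalarTower 𝕜 A A] [SMulCommClass 𝕜 A A]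
    [CompleteSpace A] {i : A →ₗᵢ[𝕜] (X →L[𝕜] X)}
    [NonUnitalNormedRing B] [NormedSpace 𝕜 B] [IsScalarTower 𝕜 B B] [SMulCommClass 𝕜 B B]
    [CompleteSpace B] {j : B →ₗᵢ[𝕜] (StrongDual 𝕜 X →L[𝕜] StrongDual 𝕜 X)}
    (hi : IsApproximableAlgebra i) (hj : IsApproximableAlgebra j) (h : IsAmenable.{u, u} 𝕜 B) :
    IsAmenable.{u, v} 𝕜 A := by
  obtain ⟨M, hM⟩ := h.exists_isVirtualDiagonal
  obtain ⟨m, hm⟩ := hi.exists_isVirtualIdentity hj hM.isVirtualIdentity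
  obtain ⟨L, hL⟩ := hi.exists_leftIdeal_action (j := j)
  choose θ hθ using hi.exists_adjointL_eq hj
  obtain ⟨M', hM'⟩ := hM.of_leftIdeal hm θ
    (fun a b hab => i.injective <| by
      rw [← sub_eq_zero, ← norm_eq_zero, ← norm_adjointL, map_sub, ← hθ, ← hθ, hab, sub_self,
        norm_zero])
    (fun a b => j.injective <| by
      rw [hθ, hj.map_mul, hθ, hθ, hi.map_mul]
      rfl) L
    (fun b a => j.injective <| by rw [hθ, hL, hj.map_mul, hθ])
  intro E _ _ _ N D hD
  exact hM'.isInner N D hD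

/-- The inclusion of the approximable operators in all bounded operators. -/
noncomputable def approximableOperators.inclusion (𝕜 : Type*) [RCLike 𝕜] (X : Type*)
    [NormedAddCommGroup X] [NormedSpace 𝕜 X] : approximableOperators 𝕜 X →ₗᵢ[𝕜] (X →L[𝕜] X) where
  toFun := Subtype.val
  map_add' _ _ := rfl
  map_smul' _ _ := rfl
  norm_map' _ := rfl

theorem approximableOperators.isApproximableAlgebra (𝕜 : Type*) [RCLike 𝕜] (X : Type*)
    [NormedAddCommGroup X] [NormedSpace 𝕜 X] :
    IsApproximableAlgebra (approximableOperators.inclusion 𝕜 X) where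
  map_mul _ _ := rfl
  range_eq := Subtype.range_coe

end DualAmenability

theorem corollary5p3 (𝕜 : Type) [RCLike 𝕜]
    (X : Type u) [NormedAddCommGroup X] [NormedSpace 𝕜 X] [CompleteSpace X]
    (h : IsAmenable.{u, u} 𝕜 (approximableOperators 𝕜 (StrongDual 𝕜 X))) :
    IsAmenable.{u, v} 𝕜 (approximableOperators 𝕜 X) := by
  exact (approximableOperators.isApproximableAlgebra 𝕜 X).isAmenable_of_dual
    (approximableOperators.isApproximableAlgebra 𝕜 (StrongDual 𝕜 X)) h
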